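/- Consider $n$ sporadic DAG tasks $\tau_1,\dots,\tau_n$ on $m$ unit-speed processors. Task $\tau_i$ is a finite directed acyclic graph with $N_i$ vertices $v$ of worst-case execution times $c(v)\ge 0$, and has a period $T_i$ and a relative deadline $0<D_i\le T_i$. Let $C_i=\sum_v c(v)$, let $L_i$ be the largest total weight of a path of $\tau_i$, call $\tau_i$ heavy if $C_i/D_i>1$ and light otherwise, and assume $L_i<D_i$ for heavy tasks. For heavy $\tau_i$ put $\gamma_i=\frac{C_i-L_i}{D_i-L_i}$, $\delta_i=\gamma_i-\lfloor\gamma_i\rfloor$ and $\delta_i^*=\max\left(\frac{\delta_i}{2},\frac{\delta_i}{\gamma_i}\right)$; for light $\tau_i$ put $\delta_i=\delta_i^*=C_i/D_i$. The second semi-federated algorithm works as follows (it fails if some step is impossible; ties are broken arbitrarily). Each heavy task gets $\lfloor\gamma_i\rfloor$ dedicated processors and a container task $\varphi_i$ of load bound $\delta_i$; a light task $\tau_i$ is itself a sequential task $\varphi_i$. Let $\Omega$ be the set of the remaining processors. (1) In non-increasing order of $\delta_i^*$, each $\varphi_i$ is put on a processor of $\Omega$ with minimal sum of $\delta^*$ among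 those where this sum stays at most $1$; a processor whose sum of $\delta$ now exceeds $1$ is moved from $\Omega$ to a set $\Psi$. (2) For each processor in $\Psi$, let $w$ be its sum of $\delta$ minus $1$, and go through the container tasks $\varphi_k$ on it in any order: if $\delta_k-\delta_k^*>w$, divide $\varphi_k$ into container tasks with load bounds $\delta_k'=\delta_k-w$ and $\delta_k''=w$ and stop; otherwise divide it into $\delta_k'=\delta_k^*$ and $\delta_k''=\delta_k-\delta_k^*$, and decrease $w$ by $\delta_k''$. The first part stays. (3) The second parts are packed, in non-increasing order of load bound, on the processors left in $\Omega$ by Worst-Fit: each on a processor with minimal sum of $\delta$ among those where this sum stays at most $1$. So a heavy task is executed through $\lfloor\gamma_i\rfloor$ containers of load bound $1$ and at most two fractional containers (containers of load bound $0$ are ignored). At runtime, the containers of a heavy task are used as follows in each release. A container is occupied from the assignment of a vertex until its absolute deadline, and empty otherwise. A vertex is eligible if it has not been assigned yet and all its predecessors are finished. Whenever there are an eligible vertex and an empty container, at a time $t$, take any eligible vertex $v$ and an empty container $p$ with the largest load bound $\delta_p$, and let $d'$ be the earliest deadline of the occupied containers with load bound larger than $\delta_p$ ($d'=\infty$ if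 there are none). If $t+c(v)/\delta_p<d'$, assign $v$ to $p$ with absolute deadline $t+c(v)/\delta_p$. Otherwise split $v$ into $v'$ with $c(v')=(d'-t)\delta_p$ and a new vertex $v''$ with $c(v'')=c(v)-c(v')$, where $v'$ precedes $v''$ and $v''$ precedes the successors of $v$; assign $v'$ to $p$ with absolute deadline $d'$, and leave $v''$ to be assigned later. Light tasks are executed sequentially and are not dispatched. Theorem. If the second semi-federated algorithm succeeds, then in each release of each task $\tau_i$, the number of extra vertices created by runtime dispatching is at most $2N_i$ (whatever ties are broken, whichever eligible vertices are selected, and whenever the assigned vertices finish). -/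

import Mathlib

namespace SemiFed

/-! ### Task model -/

/-- A sporadic DAG task: a finite DAG on the `N` vertices `Fin N`, a WCET for every vertex, a period
and a constrained relative deadline. -/
structure DAGTask where
  /-- the number of vertices -/
  N : ℕ
  /-- `edge u v`: vertex `v` can only be executed after `u` is finished -/
  edge : Fin N → Fin N → Prop
  acyclic : ∀ v, ¬ Relation.TransGen edge v v
  /-- worst-case execution times on a unit speed processor -/
  wcet : Fin N → ℝ
  wcet_nonneg : ∀ v, 0 ≤ wcet v
  /-- the period -/
  T : ℝ
  /-- the relative deadline -/
  D : ℝ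
  D_pos : 0 < D
  D_le_T : D ≤ T

noncomputable section

open Classical in
/-- The weight of the longest chain (critical path). Weights are nonnegative, so the maximum over
chains of the precedence order is the maximum over paths. -/
def DAGTask.L (τ : DAGTask) : ℝ :=
  (Finset.univ.filter fun s : Finset (Fin τ.N) =>
    IsChain (Relation.TransGen τ.edge) (s : Set (Fin τ.N))).sup'
      ⟨∅, by simp⟩ (fun s => ∑ v ∈ s, τ.wcet v)

/-- Total WCET. -/
def DAGTask.C (τ : DAGTask) : ℝ := ∑ v, τ.wcet v

def DAGTask.density (τ : DAGTask) : ℝ := τ.C / τ.D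

/-- Heavy tasks have density larger than one; the other tasks are light. -/
def DAGTask.Heavy (τ : DAGTask) : Prop := 1 < τ.density

/-- The minimal capacity requirement. -/
def DAGTask.gamma (τ : DAGTask) : ℝ := (τ.C - τ.L) / (τ.D - τ.L)

open Classical in
/-- The number of dedicated processors granted to a task. -/
def DAGTask.dedicated (τ : DAGTask) : ℕ := if τ.Heavy then ⌊τ.gamma⌋₊ else 0

open Classical in
/-- The load `δ` of the sequential task that stands for `τ` in the partitioning phase: the
container task created for `τ` if `τ` is heavy, and `τ` itself if it is light. -/
def DAGTask.load (τ : DAGTask) : ℝ :=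
  if τ.Heavy then τ.gamma - (⌊τ.gamma⌋ : ℝ) else τ.density

open Classical in
/-- The value `δ*`: the minimal load bound of the larger part if the container task is divided in
two; for a light task, its density. -/
def DAGTask.minLoad (τ : DAGTask) : ℝ :=
  if τ.Heavy then
    max ((τ.gamma - (⌊τ.gamma⌋ : ℝ)) / 2) ((τ.gamma - (⌊τ.gamma⌋ : ℝ)) / τ.gamma)
  else τ.density

/-! ### The second semi-federated algorithm

The sequential task of `τ i` is named `i`. There are `r` shared processors `Fin r`. The algorithm
breaks ties arbitrarily, hence it is described by relations. -/

/-- State of the first packing loop: the sequential tasks on each processor, and the set `Ψ`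
of processors that were removed from `Ω` because their load exceeds one. -/
structure PackState (n r : ℕ) where
  assigned : Fin r → Finset (Fin n)
  full : Finset (Fin r)

open Classical in
/-- The sequential task `k` is put on a processor of `Ω` that has minimal total `δ*` among those
which can accommodate it; the processor moves to `Ψ` if its total `δ` now exceeds one. -/
def PackStep {n r : ℕ} (δ δs : Fin n → ℝ) (s : PackState n r) (k : Fin n)
    (s' : PackState n r) : Prop :=
  ∃ x : Fin r, x ∉ s.full ∧ δs k + ∑ i ∈ s.assigned x, δs i ≤ 1 ∧
    (∀ y, y ∉ s.full → δs k + ∑ i ∈ s.assigned y, δs i ≤ 1 →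
      ∑ i ∈ s.assigned x, δs i ≤ ∑ i ∈ s.assigned y, δs i) ∧
    s' = { assigned := Function.update s.assigned x (insert k (s.assigned x))
           full := if 1 < ∑ i ∈ insert k (s.assigned x), δ i then insert x s.full else s.full }

/-- The packing loop over a list of sequential tasks, no step of which fails. -/
inductive PackAll {n r : ℕ} (δ δs : Fin n → ℝ) :
    PackState n r → List (Fin n) → PackState n r → Prop
  | nil (s : PackState n r) : PackAll δ δs s [] s
  | cons {s s' s'' : PackState n r} {k : Fin n} {ks : List (Fin n)} :
      PackStep δ δs s k s' → PackAll δ δs s' ks s'' → PackAll δ δs s (k :: ks) s''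

open Classical in
/-- The function `Scrape`: given the excess `w` of a processor and the list of the container tasks
on it, returns the second parts `(k, δ'')` of the divided container tasks. The first part of `k`
stays on the processor and keeps the load `δ k - δ''`. -/
def scrape {n : ℕ} (δ δs : Fin n → ℝ) : ℝ → List (Fin n) → List (Fin n × ℝ)
  | _, [] => []
  | w, k :: ks =>
      if w < δ k - δs k then [(k, w)]
      else (k, δ k - δs k) :: scrape δ δs (w - (δ k - δs k)) ks

/-- Worst-Fit packing of a list of loads on the processors in `Ω`, without failure;
the state is the current load of each processor. -/
inductive WorstFit {r : ℕ} (Ω : Finset (Fin r)) : (Fin r → ℝ) → List ℝ → Prop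
  | nil (ld : Fin r → ℝ) : WorstFit Ω ld []
  | cons {ld : Fin r → ℝ} {a : ℝ} {as : List ℝ} {x : Fin r} :
      x ∈ Ω → ld x + a ≤ 1 → (∀ y ∈ Ω, ld y + a ≤ 1 → ld x ≤ ld y) →
      WorstFit Ω (Function.update ld x (ld x + a)) as → WorstFit Ω ld (a :: as)

/-- `Succeeds τ m second`: on the task set `τ` and `m` unit speed processors, the algorithm has a
successful execution in which `second i = some δ''` if the container task of `τ i` was divided and
its second part has load bound `δ''`, and `second i = none` if it was not divided. -/
def Succeeds {n : ℕ} (τ : Fin n → DAGTask) (m : ℕ) (second : Fin n → Option ℝ) : Prop :=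
  -- all heavy tasks get their dedicated processors
  ∑ i, (τ i).dedicated ≤ m ∧
  -- the first packing loop, in an order of non-increasing `δ*`, on the remaining processors
  ∃ (order : List (Fin n)) (s : PackState n (m - ∑ i, (τ i).dedicated)),
    order.Nodup ∧ (∀ i, i ∈ order) ∧
    order.Pairwise (fun i j => (τ j).minLoad ≤ (τ i).minLoad) ∧
    PackAll (fun i => (τ i).load) (fun i => (τ i).minLoad) ⟨fun _ => ∅, ∅⟩ order s ∧
    -- scraping the overfull processors
    ∃ (conts : Fin (m - ∑ i, (τ i).dedicated) → List (Fin n)) (SS : List (Fin n × ℝ)),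
      (∀ x, (conts x).Nodup ∧ ∀ k, k ∈ conts x ↔ k ∈ s.assigned x ∧ (τ k).Heavy) ∧
      SS = ((List.finRange _).filter (· ∈ s.full)).flatMap (fun x =>
        scrape (fun i => (τ i).load) (fun i => (τ i).minLoad)
          (∑ k ∈ s.assigned x, (τ k).load - 1) (conts x)) ∧
      -- packing the second parts, in non-increasing order, on the processors left in `Ω`
      (∃ loads : List ℝ, loads.Perm (SS.map Prod.snd) ∧ loads.Pairwise (fun a b => b ≤ a) ∧
        WorstFit (s.full)ᶜ (fun x => ∑ k ∈ s.assigned x, (τ k).load) loads) ∧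
      -- the result: `SS` holds at most one second part of each container task
      ∀ i, second i = SS.lookup i

open Classical in
/-- The load bounds of the container tasks through which `τ` is executed: one container of load
bound `1` for each dedicated processor, and the one or two fractional containers. Containers
with load bound `0` have no processing capacity and do not count. A light task is executed as an
ordinary sequential task: it has no containers and is not dispatched. -/
def containers (τ : DAGTask) (second : Option ℝ) : List ℝ :=
  if τ.Heavy then
    List.replicate τ.dedicated 1 ++
      (match second with
        | none => [τ.load]
        | some d => [τ.load - d, d]).filter (fun a => 0 < a)
  else []

/-! ### The runtime dispatcher -/

/-- Vertices of the DAG that evolves at runtime: `(v, 0)` is the original vertex `v`, and when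
`(v, k)` is split, its first part is still called `(v, k)` and its second part `(v, k + 1)`. -/
abbrev Part (τ : DAGTask) : Type := Fin τ.N × ℕ

/-- Runtime state of one release of `τ`, executed through `m` container tasks. -/
structure DState (τ : DAGTask) (m : ℕ) where
  /-- the current time -/
  now : ℝ
  /-- the vertices of the current DAG -/
  verts : Finset (Part τ)
  /-- their WCETs -/
  wcet : Part τ → ℝ
  /-- the set `S` of vertices which have not been assigned to a container -/
  pending : Finset (Part τ)
  /-- the vertices whose execution is finished -/
  finished : Finset (Part τ)
  /-- the vertex last assigned to each container -/
  exe : Fin m → Option (Part τ)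
  /-- the absolute deadline of each container -/
  dl : Fin m → ℝ

namespace DState

variable {τ : DAGTask} {m : ℕ}

/-- The state at the release time `t₀`. -/
def init (τ : DAGTask) (m : ℕ) (t₀ : ℝ) : DState τ m where
  now := t₀
  verts := Finset.univ ×ˢ {0}
  wcet := fun x => τ.wcet x.1
  pending := Finset.univ ×ˢ {0}
  finished := ∅
  exe := fun _ => none
  dl := fun _ => t₀

/-- A container is occupied from the assignment of a vertex until its absolute deadline. -/
def Occupied (s : DState τ m) (p : Fin m) : Prop := s.exe p ≠ none ∧ s.now < s.dl p

/-- Precedence in the current DAG: consecutive parts of one vertex, and edges of the original DAG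
from the last part of a vertex to the first part of another one. -/
def Prec (s : DState τ m) (x y : Part τ) : Prop :=
  x ∈ s.verts ∧ y ∈ s.verts ∧
    ((x.1 = y.1 ∧ y.2 = x.2 + 1) ∨
      (τ.edge x.1 y.1 ∧ (x.1, x.2 + 1) ∉ s.verts ∧ y.2 = 0))

/-- A vertex in `S` is eligible if all its predecessors have been finished. -/
def Eligible (s : DState τ m) (x : Part τ) : Prop :=
  x ∈ s.pending ∧ ∀ y, s.Prec y x → y ∈ s.finished

/-- `p` is an empty container with the largest load bound. -/
def FastestEmpty (δ : Fin m → ℝ) (s : DState τ m) (p : Fin m) : Prop :=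
  ¬ s.Occupied p ∧ ∀ q, ¬ s.Occupied q → δ q ≤ δ p

/-- `q` is an occupied container with load bound strictly larger than that of `p`. -/
def FasterOccupied (δ : Fin m → ℝ) (s : DState τ m) (p q : Fin m) : Prop :=
  s.Occupied q ∧ δ p < δ q

open Classical in
/-- The state after the whole vertex `x` is assigned to `p`. -/
def assignWhole (δ : Fin m → ℝ) (s : DState τ m) (x : Part τ) (p : Fin m) : DState τ m :=
  { s with
    pending := s.pending.erase x
    exe := Function.update s.exe p (some x)
    dl := Function.update s.dl p (s.now + s.wcet x / δ p) }

open Classical in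
/-- The state after `x` is split, its first part is assigned to `p` with absolute deadline `d`,
and its second part is put back to `S`. -/
def assignSplit (δ : Fin m → ℝ) (s : DState τ m) (x : Part τ) (p : Fin m) (d : ℝ) :
    DState τ m :=
  { s with
    verts := insert (x.1, x.2 + 1) s.verts
    wcet := Function.update (Function.update s.wcet x ((d - s.now) * δ p)) (x.1, x.2 + 1)
      (s.wcet x - (d - s.now) * δ p)
    pending := insert (x.1, x.2 + 1) (s.pending.erase x)
    exe := Function.update s.exe p (some x)
    dl := Function.update s.dl p d }

open Classical in
/-- One step at runtime, for containers with load bounds `δ`. -/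
inductive Step (δ : Fin m → ℝ) : DState τ m → DState τ m → Prop
  /-- The dispatcher assigns an entire eligible vertex to the fastest empty container, because
  it would end before the deadlines of all faster occupied containers (in particular, if there
  are no such containers). -/
  | whole (s : DState τ m) (x : Part τ) (p : Fin m) :
      s.Eligible x → FastestEmpty δ s p →
      (∀ q, FasterOccupied δ s p q → s.now + s.wcet x / δ p < s.dl q) →
      Step δ s (assignWhole δ s x p)
  /-- Otherwise the dispatcher splits the vertex, and the deadline of the first part is the
  earliest deadline of the faster occupied containers. -/
  | split (s : DState τ m) (x : Part τ) (p q : Fin m) :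
      s.Eligible x → FastestEmpty δ s p →
      FasterOccupied δ s p q → (∀ q', FasterOccupied δ s p q' → s.dl q ≤ s.dl q') →
      ¬ s.now + s.wcet x / δ p < s.dl q →
      Step δ s (assignSplit δ s x p (s.dl q))
  /-- A vertex that was assigned to a container finishes its execution. When this happens is
  decided by the scheduler of the processors (and by actual execution times), so it is left
  arbitrary here. -/
  | finish (s : DState τ m) (x : Part τ) :
      x ∈ s.verts → x ∉ s.pending → x ∉ s.finished →
      Step δ s { s with finished := insert x s.finished }
  /-- Time passes, at most until the next absolute deadline of an occupied container, and only if
  the dispatcher need not be invoked. -/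
  | advance (s : DState τ m) (t : ℝ) :
      s.now < t → (∀ p, s.Occupied p → t ≤ s.dl p) →
      (¬ ∃ x p, s.Eligible x ∧ ¬ s.Occupied p) →
      Step δ s { s with now := t }

/-- The states that runtime dispatching can reach in a release of `τ` at time `t₀`. -/
def Reachable (δ : Fin m → ℝ) (t₀ : ℝ) (s : DState τ m) : Prop :=
  Relation.ReflTransGen (Step δ) (init τ m t₀) s

/-- The vertices of the current DAG which are not vertices of the original DAG. -/
def extraVertices (s : DState τ m) : Finset (Part τ) :=
  s.verts \ (Finset.univ ×ˢ {0})

end DState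

end

end SemiFed

namespace SemiFed

/-! ### Load bounds of the containers -/

/-! A split copies the deadline of a faster occupied container, so the deadline of every occupied
container goes back, through copies, to the assignment of a whole vertex. A whole assignment removes
an element of `pending`, while a split removes one and puts one back; hence at most `N` deadline
values ever arise. A container is reused only once its deadline has passed, and a split on it sets a
future deadline. The splits on one container thus have distinct deadlines, and there are at most `N`
of them. Nothing is faster than a container of load bound 1, so splits happen only on the fractional
containers, of which there are at most two: `2 * N` in total. `SplitInvariant` and
`Reachable.card_extraVertices_le` carry the count; `Succeeds.second_bounds` ensures that no load
bound exceeds 1. -/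

theorem DAGTask.one_lt_gamma {τ : DAGTask} (h : τ.Heavy) (hL : τ.L < τ.D) : 1 < τ.gamma := by
  have hC : τ.D < τ.C := (one_lt_div τ.D_pos).1 h
  exact (one_lt_div (sub_pos.2 hL)).2 (by linarith)

theorem DAGTask.load_eq_fract {τ : DAGTask} (h : τ.Heavy) : τ.load = Int.fract τ.gamma := by
  simp only [DAGTask.load, if_pos h, Int.fract]

theorem DAGTask.minLoad_eq {τ : DAGTask} (h : τ.Heavy) :
    τ.minLoad = max (Int.fract τ.gamma / 2) (Int.fract τ.gamma / τ.gamma) := by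
  simp only [DAGTask.minLoad, if_pos h, Int.fract]

theorem DAGTask.load_le_one {τ : DAGTask} (h : τ.Heavy) : τ.load ≤ 1 := by
  rw [DAGTask.load_eq_fract h]
  exact (Int.fract_lt_one _).le

theorem DAGTask.minLoad_nonneg {τ : DAGTask} (h : τ.Heavy) : 0 ≤ τ.minLoad := by
  rw [DAGTask.minLoad_eq h]
  exact le_max_of_le_left (div_nonneg (Int.fract_nonneg _) zero_le_two)

theorem DAGTask.minLoad_le_load {τ : DAGTask} (h : τ.Heavy) (hL : τ.L < τ.D) :
    τ.minLoad ≤ τ.load := by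
  have h0 := Int.fract_nonneg τ.gamma
  rw [DAGTask.minLoad_eq h, DAGTask.load_eq_fract h]
  exact max_le (half_le_self h0) (div_le_self h0 (DAGTask.one_lt_gamma h hL).le)

/-- A step only touches a processor outside `full`, so the load of a processor is frozen once it is
moved there. This makes the excess positive when scraping starts. -/
theorem PackStep.one_lt_of_mem_full {n r : ℕ} {δ δs : Fin n → ℝ} {s s' : PackState n r}
    {k : Fin n} (h : PackStep δ δs s k s')
    (hs : ∀ x ∈ s.full, 1 < ∑ i ∈ s.assigned x, δ i) :
    ∀ x ∈ s'.full, 1 < ∑ i ∈ s'.assigned x, δ i := by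
  classical
  obtain ⟨x, hx, -, -, rfl⟩ := h
  intro y hy
  dsimp only at hy ⊢
  by_cases hyx : y = x
  · subst hyx
    split_ifs at hy with hlt
    · rw [Function.update_self]
      convert hlt
    · exact absurd hy hx
  · rw [Function.update_of_ne hyx]
    refine hs y ?_
    split_ifs at hy
    · exact (Finset.mem_insert.1 hy).resolve_left hyx
    · exact hy

theorem PackAll.one_lt_of_mem_full {n r : ℕ} {δ δs : Fin n → ℝ} {s s' : PackState n r}
    {ks : List (Fin n)} (h : PackAll δ δs s ks s')
    (hs : ∀ x ∈ s.full, 1 < ∑ i ∈ s.assigned x, δ i) :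
    ∀ x ∈ s'.full, 1 < ∑ i ∈ s'.assigned x, δ i := by
  induction h with
  | nil s => exact hs
  | cons hstep _ ih => exact ih (hstep.one_lt_of_mem_full hs)

/-- The recursion continues only if the excess is at least the amount just scraped, so `w` stays
nonnegative. -/
theorem mem_scrape {n : ℕ} {δ δs : Fin n → ℝ} {ks : List (Fin n)}
    (hks : ∀ k ∈ ks, δs k ≤ δ k) {w : ℝ} (hw : 0 ≤ w) {i : Fin n} {d : ℝ}
    (h : (i, d) ∈ scrape δ δs w ks) : i ∈ ks ∧ 0 ≤ d ∧ d ≤ δ i - δs i := by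
  induction ks generalizing w with
  | nil => simp [scrape] at h
  | cons k ks ih =>
    have hk := hks k List.mem_cons_self
    rw [scrape] at h
    split_ifs at h with hlt
    · obtain ⟨rfl, rfl⟩ := Prod.mk.inj (List.mem_singleton.1 h)
      exact ⟨List.mem_cons_self, hw, hlt.le⟩
    · rcases List.mem_cons.1 h with h | h
      · obtain ⟨rfl, rfl⟩ := Prod.mk.inj h
        exact ⟨List.mem_cons_self, sub_nonneg.2 hk, le_rfl⟩
      · obtain ⟨hi, hd⟩ := ih (fun k hk => hks k (List.mem_cons_of_mem _ hk))
          (sub_nonneg.2 (not_lt.1 hlt)) h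
        exact ⟨List.mem_cons_of_mem _ hi, hd⟩

theorem mem_of_lookup_eq_some {α β : Type*} [BEq α] [LawfulBEq α] {a : α} {b : β}
    {l : List (α × β)} (h : l.lookup a = some b) : (a, b) ∈ l := by
  obtain ⟨l₁, l₂, rfl, -⟩ := List.lookup_eq_some_iff.1 h
  simp

/-- Both bounds serve to keep containers at load at most 1: the upper one for the second part `d`,
the lower one for the first part `load - d`. -/
theorem Succeeds.second_bounds {n m : ℕ} {τ : Fin n → DAGTask} {second : Fin n → Option ℝ}
    (h : Succeeds τ m second) (hL : ∀ i, (τ i).Heavy → (τ i).L < (τ i).D) {i : Fin n} {d : ℝ}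
    (hd : second i = some d) : 0 ≤ d ∧ d ≤ (τ i).load := by
  obtain ⟨-, order, s, -, -, -, hpack, conts, SS, hconts, rfl, -, hsecond⟩ := h
  obtain ⟨x, hx, hmem⟩ := List.mem_flatMap.1 (mem_of_lookup_eq_some ((hsecond i).symm.trans hd))
  have hfull : x ∈ s.full := by simpa using (List.mem_filter.1 hx).2
  have hlt := hpack.one_lt_of_mem_full (by simp) x hfull
  have hheavy : ∀ k ∈ conts x, (τ k).Heavy := fun k hk => (((hconts x).2 k).1 hk).2
  obtain ⟨hi, h0, hle⟩ := mem_scrape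
    (fun k hk => DAGTask.minLoad_le_load (hheavy k hk) (hL k (hheavy k hk)))
    (sub_nonneg.2 hlt.le) hmem
  exact ⟨h0, hle.trans (sub_le_self _ (DAGTask.minLoad_nonneg (hheavy i hi)))⟩

/-- The list of containers consists of dedicated ones and at most two others; none of them has a
load bound larger than one. -/
theorem exists_containers_eq {τ : DAGTask} {second : Option ℝ}
    (h : ∀ d, second = some d → 0 ≤ d ∧ d ≤ τ.load) :
    ∃ (k : ℕ) (l : List ℝ), containers τ second = List.replicate k 1 ++ l ∧ l.length ≤ 2 ∧
      ∀ a ∈ l, a ≤ 1 := by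
  unfold containers
  split_ifs with hτ
  · refine ⟨_, _, rfl, (List.length_filter_le _ _).trans ?_, fun a ha => ?_⟩
    · cases second <;> simp
    · have hload := DAGTask.load_le_one hτ
      have ha := (List.mem_filter.1 ha).1
      cases second with
      | none => exact (List.mem_singleton.1 ha).trans_le hload
      | some d =>
        obtain ⟨h0, hd⟩ := h d rfl
        simp only [List.mem_cons, List.not_mem_nil, or_false] at ha
        rcases ha with rfl | rfl <;> linarith
  · exact ⟨0, [], rfl, by simp, by simp⟩

/-- Positions below `k` hold the dedicated containers, so load bounds below 1 occur only among the
last `l.length` positions. -/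
theorem card_filter_get_lt_one_le {k : ℕ} {l L : List ℝ} (hL : L = List.replicate k 1 ++ l) :
    (Finset.univ.filter fun p => L.get p < 1).card ≤ l.length := by
  subst hL
  have : (Finset.univ.filter fun p => (List.replicate k (1 : ℝ) ++ l).get p < 1).card ≤
      (Finset.Ico k (k + l.length)).card := by
    refine Finset.card_le_card_of_injOn Fin.val (fun p hp => ?_) Fin.val_injective.injOn
    have hp : (List.replicate k (1 : ℝ) ++ l).get p < 1 := by simpa using hp
    refine Finset.mem_coe.2 (Finset.mem_Ico.2 ⟨?_, by simpa using p.2⟩)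
    by_contra hlt
    rw [List.get_eq_getElem, List.getElem_append_left (by simpa using hlt)] at hp
    simp at hp
  simpa using this

/-! ### Counting the splits -/

namespace DState

variable {τ : DAGTask} {m : ℕ}

/-- `A` contains the deadlines set by assignments of whole vertices, and `S p` the deadlines set by
splits on the container `p`. A split copies the deadline of an occupied container, so `S p` is
contained in `A`, and the deadlines set on `p` are strictly increasing. -/
structure SplitInvariant (δ : Fin m → ℝ) (s : DState τ m) (A : Finset ℝ)
    (S : Fin m → Finset ℝ) : Prop where
  card_add_card : A.card + s.pending.card ≤ τ.N
  subset : ∀ p, S p ⊆ A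
  dl_mem : ∀ p, s.Occupied p → s.dl p ∈ A
  -- The conjunct `s.exe p ≠ none` is needed so that, when `p` is empty, its deadline must have
  -- passed.
  le_dl : ∀ p, ∀ d ∈ S p, d ≤ s.now ∨ s.exe p ≠ none ∧ d ≤ s.dl p
  eq_empty : ∀ p, 1 ≤ δ p → S p = ∅
  card_extra : s.extraVertices.card ≤ ∑ p, (S p).card

variable {δ : Fin m → ℝ} {s s' : DState τ m} {A : Finset ℝ} {S : Fin m → Finset ℝ}

/-- This is the source of distinctness: a future deadline cannot already be recorded for an empty
container. -/
theorem SplitInvariant.le_now (h : SplitInvariant δ s A S) {p : Fin m} (hp : ¬ s.Occupied p)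
    {d : ℝ} (hd : d ∈ S p) : d ≤ s.now := by
  rcases h.le_dl p d hd with h | ⟨h1, h2⟩
  · exact h
  · exact h2.trans (not_lt.1 fun hlt => hp ⟨h1, hlt⟩)

theorem splitInvariant_init (t₀ : ℝ) :
    SplitInvariant δ (init τ m t₀) ∅ fun _ => ∅ where
  card_add_card := by simp [init]
  subset := by simp
  dl_mem p hp := absurd rfl hp.1
  le_dl := by simp
  eq_empty := by simp
  card_extra := by simp [extraVertices, init]

/-- The possible new element of `A` is paid for by `x` leaving `pending`. The new deadline is not
recorded in `S p`, as no split occurred. -/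
theorem SplitInvariant.assignWhole (h : SplitInvariant δ s A S) {x : Part τ} {p : Fin m}
    (hx : s.Eligible x) (hp : ¬ s.Occupied p) :
    SplitInvariant δ (s.assignWhole δ x p) (insert (s.now + s.wcet x / δ p) A) S where
  card_add_card := by
    have h1 := Finset.card_insert_le (s.now + s.wcet x / δ p) A
    have h2 := Finset.card_erase_add_one hx.1
    have h3 := h.card_add_card
    simp only [DState.assignWhole]
    convert (by omega : (insert (s.now + s.wcet x / δ p) A).card + (s.pending.erase x).card ≤ τ.N)
  subset q := (h.subset q).trans (Finset.subset_insert _ _)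
  dl_mem q hq := by
    by_cases hqp : q = p
    · subst hqp
      simp [DState.assignWhole]
    · simp only [Occupied, DState.assignWhole, Function.update_of_ne hqp] at hq ⊢
      exact Finset.mem_insert_of_mem (h.dl_mem q hq)
  le_dl q d hd := by
    by_cases hqp : q = p
    · subst hqp
      exact Or.inl (h.le_now hp hd)
    · simpa only [DState.assignWhole, Function.update_of_ne hqp] using h.le_dl q d hd
  eq_empty := h.eq_empty
  card_extra := h.card_extra

theorem SplitInvariant.assignSplit (h : SplitInvariant δ s A S) {x : Part τ} {p q : Fin m}
    (hδ : ∀ p, δ p ≤ 1) (hx : s.Eligible x) (hp : ¬ s.Occupied p)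
    (hq : FasterOccupied δ s p q) :
    SplitInvariant δ (s.assignSplit δ x p (s.dl q)) A
      (Function.update S p (insert (s.dl q) (S p))) where
  card_add_card := by
    classical
    -- The second part takes the place of `x`, so `pending` does not grow and `A` can stay the same.
    have h1 := Finset.card_insert_le (x.1, x.2 + 1) (s.pending.erase x)
    have h2 := Finset.card_erase_add_one hx.1
    have h3 := h.card_add_card
    simp only [DState.assignSplit]
    convert (by omega :
      A.card + (insert (x.1, x.2 + 1) (s.pending.erase x)).card ≤ τ.N)
  subset p' := by
    by_cases hp' : p' = p
    · subst hp'
      rw [Function.update_self]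
      exact Finset.insert_subset (h.dl_mem q hq.1) (h.subset p')
    · rw [Function.update_of_ne hp']
      exact h.subset p'
  dl_mem p' hocc := by
    by_cases hp' : p' = p
    · subst hp'
      simpa [DState.assignSplit] using h.dl_mem q hq.1
    · simp only [Occupied, DState.assignSplit, Function.update_of_ne hp'] at hocc ⊢
      exact h.dl_mem p' hocc
  le_dl p' d hd := by
    by_cases hp' : p' = p
    · subst hp'
      rw [Function.update_self] at hd
      rcases Finset.mem_insert.1 hd with rfl | hd
      · exact Or.inr (by simp [DState.assignSplit])
      · exact Or.inl (h.le_now hp hd)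
    · rw [Function.update_of_ne hp'] at hd
      simpa only [DState.assignSplit, Function.update_of_ne hp'] using h.le_dl p' d hd
  eq_empty p' hp1 := by
    have hp' : p' ≠ p := by
      -- A split on `p` needs a strictly faster `q`, whose load bound is at most 1.
      rintro rfl
      exact absurd (hq.2.trans_le (hδ q)) (not_lt.2 hp1)
    rw [Function.update_of_ne hp']
    exact h.eq_empty p' hp1
  card_extra := by
    classical
    -- As `q` is occupied, its deadline is in the future; those recorded for the empty `p` are not.
    have hnew : s.dl q ∉ S p := fun hmem => absurd hq.1.2 (not_lt.2 (h.le_now hp hmem))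
    have hsum : ∑ p', (Function.update S p (insert (s.dl q) (S p)) p').card =
        ∑ p', (S p').card + 1 := by
      rw [← Finset.add_sum_erase _ _ (Finset.mem_univ p),
        ← Finset.add_sum_erase _ (fun p' => (S p').card) (Finset.mem_univ p),
        Function.update_self, Finset.card_insert_of_notMem hnew,
        Finset.sum_congr rfl fun p' hp' => by rw [Function.update_of_ne (Finset.ne_of_mem_erase hp')]]
      ring
    -- An inclusion suffices for the upper bound, so freshness of the second part need not be shown.
    have hsub : (s.assignSplit δ x p (s.dl q)).extraVertices ⊆
        insert (x.1, x.2 + 1) s.extraVertices := by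
      intro y hy
      simp only [extraVertices, DState.assignSplit, Finset.mem_sdiff, Finset.mem_insert] at hy ⊢
      tauto
    rw [hsum]
    exact (Finset.card_le_card hsub).trans
      ((Finset.card_insert_le _ _).trans (Nat.succ_le_succ h.card_extra))

theorem SplitInvariant.exists_of_step (hδ : ∀ p, δ p ≤ 1) (h : SplitInvariant δ s A S)
    (hstep : Step δ s s') : ∃ A' S', SplitInvariant δ s' A' S' := by
  cases hstep with
  | whole x p hx hp => exact ⟨_, _, h.assignWhole hx hp.1⟩
  | split x p q hx hp hq => exact ⟨_, _, h.assignSplit hδ hx hp.1 hq⟩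
  | finish x =>
    exact ⟨A, S, h.card_add_card, h.subset, h.dl_mem, h.le_dl, h.eq_empty, h.card_extra⟩
  | advance t ht =>
    -- A container occupied at the later time was already occupied before, since only the clock has
    -- moved.
    exact ⟨A, S, h.card_add_card, h.subset, fun p hp => h.dl_mem p ⟨hp.1, ht.trans hp.2⟩,
      fun p d hd => (h.le_dl p d hd).imp_left fun hd => hd.trans ht.le, h.eq_empty, h.card_extra⟩

theorem Reachable.exists_splitInvariant (hδ : ∀ p, δ p ≤ 1) {t₀ : ℝ} (h : Reachable δ t₀ s) :
    ∃ A S, SplitInvariant δ s A S := by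
  induction h with
  | refl => exact ⟨_, _, splitInvariant_init t₀⟩
  | tail _ hstep ih =>
    obtain ⟨A, S, hinv⟩ := ih
    exact hinv.exists_of_step hδ hstep

/-- If no load bound exceeds one, each vertex causes at most one split on each container of load
bound less than one. -/
theorem Reachable.card_extraVertices_le (hδ : ∀ p, δ p ≤ 1) {t₀ : ℝ} (h : Reachable δ t₀ s) :
    s.extraVertices.card ≤ (Finset.univ.filter fun p => δ p < 1).card * τ.N := by
  obtain ⟨A, S, hinv⟩ := h.exists_splitInvariant hδ
  calc s.extraVertices.card ≤ ∑ p, (S p).card := hinv.card_extra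
    _ = ∑ p with δ p < 1, (S p).card := by
      refine (Finset.sum_filter_of_ne fun p _ hp => not_le.1 fun h1 => hp ?_).symm
      rw [hinv.eq_empty p h1, Finset.card_empty]
    _ ≤ (Finset.univ.filter fun p => δ p < 1).card * τ.N :=
      Finset.sum_le_card_nsmul _ _ _ fun p _ => (Finset.card_le_card (hinv.subset p)).trans
        (le_of_add_le_left hinv.card_add_card)

end DState

end SemiFed

theorem theoremt (n m : ℕ) (τ : Fin n → SemiFed.DAGTask)
    (hL : ∀ i, (τ i).Heavy → (τ i).L < (τ i).D)
    (second : Fin n → Option ℝ) (hsucc : SemiFed.Succeeds τ m second)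
    (i : Fin n) (t₀ : ℝ)
    (s : SemiFed.DState (τ i) (SemiFed.containers (τ i) (second i)).length)
    (hs : SemiFed.DState.Reachable (SemiFed.containers (τ i) (second i)).get t₀ s) :
    s.extraVertices.card ≤ 2 * (τ i).N := by
  obtain ⟨k, l, hkl, hl, hl1⟩ :=
    SemiFed.exists_containers_eq fun d hd => hsucc.second_bounds hL (i := i) (d := d) hd
  have hle : ∀ a ∈ SemiFed.containers (τ i) (second i), a ≤ 1 := by
    intro a ha
    rw [hkl] at ha
    rcases List.mem_append.1 ha with ha | ha
    · exact (List.eq_of_mem_replicate ha).le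
    · exact hl1 a ha
  exact (hs.card_extraVertices_le fun p => hle _ (List.get_mem _ p)).trans
    (Nat.mul_le_mul_right _ ((SemiFed.card_filter_get_lt_one_le hkl).trans hl))
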